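/- Let $G=(V,E)$ be a finite directed acyclic graph (with $E\subseteq V\times V$), and let every node $v\in V$ carry an outcome variable $o[v]$ with values in a finite set $O_v$. Write $\mathrm{in}(v)$ and $\mathrm{out}(v)$ for the sets of edges with target $v$ and with source $v$, respectively. A *hidden variable model* on $G$ assigns to every edge $e\in E$ a non-empty measurable space $(X_e,\Sigma_e)$ and to every node $v\in V$ a conditional distribution $P(o[v]\,\lambda_{\mathrm{out}(v)}\mid\lambda_{\mathrm{in}(v)})$, that is, a Markov kernel from $\prod_{e\in\mathrm{in}(v)}X_e$ to $O_v\times\prod_{e\in\mathrm{out}(v)}X_e$ (with product $\sigma$-algebras, and all subsets of $O_v$ measurable). The model realizes the joint distribution $$P(o[V])=\int_{\lambda_E}\ \prod_{v\in V}P(o[v]\,\lambda_{\mathrm{out}(v)}\mid\lambda_{\mathrm{in}(v)}),\qquad o[V]=(o[v])_{v\in V}\in\prod_{v\in V}O_v,$$ where the right-hand side is the iterated integral over the variables $\lambda_{\mathrm{out}(v)}$, taken in any order of the nodes in which the source of every edge comes before its target (the value does not depend on this order). A joint distribution $P(o[V])$ is called a *classical correlation* on $G$ if it is realized by some hidden variable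 model on $G$. **Theorem.** Let $P(o[V])$ be a classical correlation on $G$ and let $\varepsilon>0$. Then there is a classical correlation $P'(o[V])$ on $G$, for the same outcome sets, which is realized by a hidden variable model all of whose spaces $X'_e$ are finite sets (with all subsets measurable), and such that $$|P(o[V])-P'(o[V])|<\varepsilon\qquad\text{for every value of } o[V].$$ -/

import Mathlib

open MeasureTheory ProbabilityTheory
open scoped ENNReal

universe u v w

/-- A causal structure on the set of nodes `V`: a directed acyclic graph, with at most one edge
between an ordered pair of nodes. Acyclic means that no node is joined to itself by a directed path
of positive length. -/
structure CausalStructure (V : Type u) extends Digraph V where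
  acyclic : ∀ v : V, ¬ Relation.TransGen Adj v v

namespace CausalStructure

variable {V : Type u} (G : CausalStructure V)

/-- The edges `E ⊆ V × V`. -/
abbrev Edge : Type u := {e : V × V // G.Adj e.1 e.2}

/-- The source of an edge. -/
def src (e : G.Edge) : V := e.1.1

/-- The target of an edge. -/
def tar (e : G.Edge) : V := e.1.2

/-- The incoming edges of a node. -/
abbrev In (v : V) : Type u := {e : G.Edge // G.tar e = v}

/-- The outgoing edges of a node. -/
abbrev Out (v : V) : Type u := {e : G.Edge // G.src e = v}

/-- A duplicate-free list of nodes in which the source of an edge never comes after the target. -/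
def IsOrdered (l : List V) : Prop :=
  l.Nodup ∧ l.Pairwise (fun a b => ¬ G.Adj b a)

theorem not_adj_self (v : V) : ¬ G.Adj v v :=
  fun h => G.acyclic v (Relation.TransGen.single h)

/-- The nodes of a finite directed acyclic graph can be listed in topological order. -/
theorem exists_topologicalOrder [Finite V] : ∃ l : List V, G.IsOrdered l ∧ ∀ v, v ∈ l := by
  classical
  have := Fintype.ofFinite V
  let r : V → V → Prop := Relation.ReflTransGen G.Adj
  have : IsPartialOrder V r :=
    { refl := fun a => Relation.ReflTransGen.refl
      trans := fun a b c hab hbc => hab.trans hbc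
      antisymm := fun a b hab hba => by
        rcases Relation.reflTransGen_iff_eq_or_transGen.1 hab with h | h
        · exact h.symm
        · exact (G.acyclic a (h.trans_left hba)).elim }
  obtain ⟨s, hs, hrs⟩ := extend_partialOrder r
  refine ⟨Finset.univ.sort s, ⟨Finset.sort_nodup _ _, ?_⟩, fun v => by simp⟩
  have h1 : (Finset.univ.sort s).Pairwise s := Finset.pairwise_sort _ _
  have h2 : (Finset.univ.sort s).Pairwise (· ≠ ·) := Finset.sort_nodup _ _
  refine (h1.and h2).imp ?_
  rintro a b ⟨hab, hne⟩ hba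
  exact hne (hs.antisymm a b hab (hrs b a (Relation.ReflTransGen.single hba)))

/-- A topological order of the nodes. -/
noncomputable def topologicalOrder [Finite V] : List V := G.exists_topologicalOrder.choose

end CausalStructure

/-- A classical hidden variable model on the causal structure `G` for outcomes `o[v]` with values in
`O v`: every edge `e` carries a (non-empty) measurable space `X e`, and every node `v` carries a
conditional distribution `P(o[v] λ_out(v) | λ_in(v))`, that is, a Markov kernel from the product of
the `X e` over the incoming edges to `O v` times the product of the `X e` over the outgoing
edges. -/
structure HiddenVariableModel {V : Type u} (G : CausalStructure V) (O : V → Type v)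
    [∀ v, MeasurableSpace (O v)] where
  X : G.Edge → Type w
  measurableSpace : ∀ e, MeasurableSpace (X e)
  nonempty : ∀ e, Nonempty (X e)
  gate : ∀ v : V, Kernel (∀ e : G.In v, X e.1) (O v × ∀ e : G.Out v, X e.1)
  isMarkovKernel : ∀ v : V, IsMarkovKernel (gate v)

namespace HiddenVariableModel

attribute [instance] measurableSpace nonempty isMarkovKernel

variable {V : Type u} {G : CausalStructure V} {O : V → Type v} [∀ v, MeasurableSpace (O v)]
  (M : HiddenVariableModel.{u, v, w} G O)

/-- The values `λ_E` of all hidden variables together. -/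
abbrev Config : Type (max u w) := ∀ e : G.Edge, M.X e

open Classical in
/-- Replace the values on the outgoing edges of `v` by `y`, and keep all the others. -/
noncomputable def overwrite (v : V) (x : M.Config) (y : ∀ e : G.Out v, M.X e.1) : M.Config :=
  fun e => if h : G.src e = v then y ⟨e, h⟩ else x e

/-- The integral `∫ f(λ_E) P(o[v] λ_out(v) | λ_in(v))` of a function `f` of all hidden variables over
the variables `λ_out(v)`, for the given outcome `o[v]`. It is a function of the remaining
variables. -/
noncomputable def integrateNode (o : ∀ v, O v) (v : V) (f : M.Config → ℝ≥0∞) : M.Config → ℝ≥0∞ :=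
  fun x => ∫⁻ p in {p | p.1 = o v}, f (M.overwrite v x p.2) ∂(M.gate v (fun e => x e.1))

/-- The iterated integral
`∫ P(o[v₁] λ_out(v₁) | λ_in(v₁)) ∫ P(o[v₂] λ_out(v₂) | λ_in(v₂)) ⋯ ∫ P(o[vₙ] λ_out(vₙ) | λ_in(vₙ))`
along a list `v₁, …, vₙ` of nodes, as a function of the variables that are not integrated. -/
noncomputable def iteratedIntegral (o : ∀ v, O v) : List V → M.Config → ℝ≥0∞
  | [] => fun _ => 1
  | v :: l => M.integrateNode o v (iteratedIntegral o l)

/-- The number `∫_{λ_E} ∏_v P(o[v] λ_out(v) | λ_in(v))`, as an iterated integral in a topological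
order of the nodes. All hidden variables are integrated, so it depends neither on the configuration
at which the iterated integral is evaluated nor on the order; see `prob_eq`. -/
noncomputable def prob [Finite V] (o : ∀ v, O v) : ℝ≥0∞ :=
  M.iteratedIntegral o G.topologicalOrder (fun _ => Classical.arbitrary _)

/-- The joint distribution `P` of the outcomes is the one that the model produces. -/
def Realizes [Finite V] (P : (∀ v, O v) → ℝ) : Prop :=
  ∀ o, P o = (M.prob o).toReal

section WellDefined

theorem measurable_overwrite (v : V) :
    Measurable (fun q : M.Config × (∀ e : G.Out v, M.X e.1) => M.overwrite v q.1 q.2) := by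
  refine measurable_pi_lambda _ fun e => ?_
  unfold overwrite
  by_cases h : G.src e = v
  · simp only [h, dite_true]
    exact (measurable_pi_apply (⟨e, h⟩ : G.Out v)).comp measurable_snd
  · simp only [h, dite_false]
    exact (measurable_pi_apply e).comp measurable_fst

theorem measurable_integrateNode [∀ v, DiscreteMeasurableSpace (O v)] (o : ∀ v, O v) (v : V)
    {f : M.Config → ℝ≥0∞} (hf : Measurable f) : Measurable (M.integrateNode o v f) := by
  have hs : MeasurableSet {p : O v × (∀ e : G.Out v, M.X e.1) | p.1 = o v} :=
    measurable_fst (MeasurableSet.of_discrete (s := {o v}))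
  have hr : Measurable (fun x : M.Config => fun e : G.In v => x e.1) :=
    measurable_pi_lambda _ fun e => measurable_pi_apply e.1
  have hg : Measurable (fun q : M.Config × (O v × (∀ e : G.Out v, M.X e.1)) =>
      f (M.overwrite v q.1 q.2.2)) :=
    hf.comp ((M.measurable_overwrite v).comp
      (measurable_fst.prodMk (measurable_snd.comp measurable_snd)))
  exact Measurable.lintegral_kernel_prod_right (κ := ((M.gate v).restrict hs).comap _ hr) hg

theorem measurable_iteratedIntegral [∀ v, DiscreteMeasurableSpace (O v)] (o : ∀ v, O v)
    (l : List V) : Measurable (M.iteratedIntegral o l) := by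
  induction l with
  | nil => exact measurable_const
  | cons v l ih => exact M.measurable_integrateNode o v ih

theorem overwrite_in {a b : V} (h : ¬ G.Adj a b) (x : M.Config) (y : ∀ e : G.Out a, M.X e.1)
    (e : G.In b) : M.overwrite a x y e.1 = x e.1 := by
  have : ¬ G.src e.1 = a := by
    intro h'
    have h1 := e.1.2
    have h2 := e.2
    simp only [CausalStructure.src, CausalStructure.tar] at h' h2
    rw [h', h2] at h1
    exact h h1
  simp [overwrite, this]

/-- The integrals at two nodes that are not joined by an edge may be exchanged. -/
theorem integrateNode_comm [∀ v, DiscreteMeasurableSpace (O v)] (o : ∀ v, O v) {a b : V}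
    (hab : ¬ G.Adj a b) (hba : ¬ G.Adj b a) {f : M.Config → ℝ≥0∞} (hf : Measurable f) :
    M.integrateNode o a (M.integrateNode o b f) = M.integrateNode o b (M.integrateNode o a f) := by
  by_cases hne : a = b
  · rw [hne]
  funext x
  simp only [integrateNode, M.overwrite_in hab, M.overwrite_in hba]
  have hcomm : ∀ y z, M.overwrite b (M.overwrite a x y) z = M.overwrite a (M.overwrite b x z) y := by
    intro y z
    funext e
    unfold overwrite
    by_cases h1 : G.src e = a
    · have h2 : ¬ G.src e = b := fun h2 => hne (h1.symm.trans h2)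
      simp [h1, hne]
    · by_cases h2 : G.src e = b
      · have h3 : ¬ b = a := fun h => hne h.symm
        simp [h2, h3]
      · simp [h1, h2]
  simp only [hcomm]
  refine lintegral_lintegral_swap (Measurable.aemeasurable ?_)
  refine hf.comp ((M.measurable_overwrite a).comp (Measurable.prodMk ?_ ?_))
  · exact (M.measurable_overwrite b).comp
      (measurable_const.prodMk (measurable_snd.comp measurable_snd))
  · exact measurable_snd.comp measurable_fst

theorem iteratedIntegral_append_cons [∀ v, DiscreteMeasurableSpace (O v)] (o : ∀ v, O v) (v : V)
    (s t : List V) (h : ∀ a ∈ s, ¬ G.Adj a v ∧ ¬ G.Adj v a) :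
    M.iteratedIntegral o (s ++ v :: t) = M.iteratedIntegral o (v :: (s ++ t)) := by
  induction s with
  | nil => rfl
  | cons a s ih =>
    have ih' := ih fun b hb => h b (List.mem_cons_of_mem _ hb)
    have ha := h a List.mem_cons_self
    change M.integrateNode o a (M.iteratedIntegral o (s ++ v :: t)) = _
    rw [ih']
    exact M.integrateNode_comm o ha.1 ha.2 (M.measurable_iteratedIntegral o _)

/-- The iterated integral does not depend on the choice of the topological order. -/
theorem iteratedIntegral_perm [∀ v, DiscreteMeasurableSpace (O v)] (o : ∀ v, O v) {l l' : List V}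
    (hl : G.IsOrdered l) (hl' : G.IsOrdered l') (h : l.Perm l') :
    M.iteratedIntegral o l = M.iteratedIntegral o l' := by
  induction l generalizing l' with
  | nil => rw [h.nil_eq]
  | cons v l ih =>
    obtain ⟨s, t, rfl⟩ := List.append_of_mem (h.mem_iff.1 List.mem_cons_self)
    have hp : l.Perm (s ++ t) := (List.perm_cons v).1 (h.trans List.perm_middle)
    have hsub : (s ++ t).Sublist (s ++ v :: t) :=
      List.Sublist.append (List.Sublist.refl s) (List.sublist_cons_self v t)
    rw [M.iteratedIntegral_append_cons o v s t]
    · change M.integrateNode o v _ = M.integrateNode o v _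
      rw [ih ⟨(List.nodup_cons.1 hl.1).2, (List.pairwise_cons.1 hl.2).2⟩
        ⟨hl'.1.sublist hsub, hl'.2.sublist hsub⟩ hp]
    · intro a ha
      refine ⟨(List.pairwise_cons.1 hl.2).1 a (hp.mem_iff.2 (List.mem_append_left _ ha)), ?_⟩
      exact (List.pairwise_append.1 hl'.2).2.2 a ha v List.mem_cons_self

theorem iteratedIntegral_congr (o : ∀ v, O v) {l : List V} (hl : G.IsOrdered l) (x x' : M.Config)
    (h : ∀ e, G.src e ∉ l → x e = x' e) :
    M.iteratedIntegral o l x = M.iteratedIntegral o l x' := by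
  induction l generalizing x x' with
  | nil => rfl
  | cons v l ih =>
    have hin : (fun e : G.In v => x e.1) = fun e : G.In v => x' e.1 := by
      funext e
      refine h _ fun hmem => ?_
      have hadj : G.Adj (G.src e.1) v := by
        have h1 := e.1.2
        have h2 := e.2
        simp only [CausalStructure.tar] at h2
        rw [h2] at h1
        exact h1
      rcases List.mem_cons.1 hmem with h' | h'
      · rw [h'] at hadj
        exact G.not_adj_self v hadj
      · exact (List.pairwise_cons.1 hl.2).1 _ h' hadj
    change M.integrateNode o v _ x = M.integrateNode o v _ x'
    simp only [integrateNode]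
    rw [hin]
    congr 1
    funext p
    refine ih ⟨(List.nodup_cons.1 hl.1).2, (List.pairwise_cons.1 hl.2).2⟩ _ _ fun e he => ?_
    unfold overwrite
    by_cases h' : G.src e = v
    · simp [h']
    · simp only [h', dite_false]
      exact h e fun hmem => (List.mem_cons.1 hmem).elim h' he

/-- The number `prob` is the iterated integral in any topological order, at any configuration. -/
theorem prob_eq [Finite V] [∀ v, DiscreteMeasurableSpace (O v)] (o : ∀ v, O v) {l : List V}
    (hl : G.IsOrdered l) (hmem : ∀ v, v ∈ l) (x : M.Config) :
    M.prob o = M.iteratedIntegral o l x := by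
  have h0 : G.IsOrdered G.topologicalOrder ∧ ∀ v, v ∈ G.topologicalOrder :=
    G.exists_topologicalOrder.choose_spec
  have hp : (G.topologicalOrder).Perm l :=
    (List.perm_ext_iff_of_nodup h0.1.1 hl.1).2 fun v => ⟨fun _ => hmem v, fun _ => h0.2 v⟩
  unfold prob
  rw [M.iteratedIntegral_perm o h0.1 hl hp]
  exact M.iteratedIntegral_congr o hl _ _ fun e he => (he (hmem _)).elim

end WellDefined

end HiddenVariableModel

/-- `P(o[V])` is a classical correlation on `G`: some hidden variable model, on arbitrary measurable
spaces, realizes it. -/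
def IsClassicalCorrelation {V : Type u} [Finite V] (G : CausalStructure V) {O : V → Type v}
    [∀ v, MeasurableSpace (O v)] (P : (∀ v, O v) → ℝ) : Prop :=
  ∃ M : HiddenVariableModel.{u, v, w} G O, M.Realizes P

/-! The approximation can be made exact: finite spaces already realize `P` itself. Treat the nodes
in topological order. When `v` is reached, the edges from earlier nodes carry only finitely many
values. As outcomes are finite too, the gate of `v` matters only through the means of finitely many
bounded test functions, namely the iterated integrals over the later nodes (`integrand`). Each
vector of means is a finite convex combination of values (`exists_finite_weights_lintegral_eq`),
since a mean lies in the convex hull itself and not merely in its closure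
(`Convex.integral_mem_of_finiteDimensional`). So each of the finitely many measures of the gate can
be given finite support, and the support points supply the values on the edges leaving `v`.

The test functions come from the original model. Induction from the last node backwards shows that
the replaced gates yield the same iterated integrals on the finite sets
(`iteratedIntegral_ofFinset`). -/

/-! ### Means and convex sets in finite dimension -/

/-- A convex set in a finite-dimensional space lies on one side of a hyperplane through any given
point outside it, up to the degenerate case of a set contained in a parallel hyperplane. -/
theorem Convex.exists_ne_zero_forall_le_or_forall_eq {E : Type*} [NormedAddCommGroup E]
    [NormedSpace ℝ E] [FiniteDimensional ℝ E] {C : Set E} (hC : Convex ℝ C) (hne : C.Nonempty)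
    {m : E} (hm : m ∉ C) :
    ∃ L : StrongDual ℝ E, L ≠ 0 ∧ ((∀ y ∈ C, L y ≤ L m) ∨ ∃ c, ∀ y ∈ C, L y = c) := by
  by_cases hint : (interior C).Nonempty
  · obtain ⟨L, r, hL, h1, h2⟩ := geometric_hahn_banach_of_nonempty_interior hC
      (convex_singleton m) (Set.disjoint_singleton_right.2 fun h => hm (interior_subset h)) hint
      (Set.singleton_nonempty m)
    exact ⟨L, hL, Or.inl fun y hy => (h1 y hy).trans (h2 m rfl)⟩
  -- With empty interior the affine span is proper, and a non-zero functional killing its direction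
  -- is constant on `C`.
  · rw [hC.interior_nonempty_iff_affineSpan_eq_top] at hint
    obtain ⟨y₀, hy₀⟩ := hne
    have hdir : (affineSpan ℝ C).direction < ⊤ := by
      refine lt_top_iff_ne_top.2 fun h => hint ?_
      exact (AffineSubspace.direction_eq_top_iff_of_nonempty
        ⟨y₀, subset_affineSpan ℝ C hy₀⟩).1 h
    obtain ⟨f, hf, hker⟩ := Submodule.exists_le_ker_of_lt_top _ hdir
    refine ⟨LinearMap.toContinuousLinearMap f, fun h => hf ?_, Or.inr ⟨f y₀, fun y hy => ?_⟩⟩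
    · ext x
      exact DFunLike.congr_fun h x
    · have := hker (AffineSubspace.vsub_mem_direction (subset_affineSpan ℝ C hy)
        (subset_affineSpan ℝ C hy₀))
      simpa [sub_eq_zero] using this

/-- In finite dimension, the mean of an integrable function with values in a convex set lies in that
set, whether it is closed or not. -/
theorem Convex.integral_mem_of_finiteDimensional {Ω : Type*} [MeasurableSpace Ω] (μ : Measure Ω)
    [IsProbabilityMeasure μ] {E : Type*} [NormedAddCommGroup E] [NormedSpace ℝ E]
    [FiniteDimensional ℝ E] {C : Set E} (hC : Convex ℝ C) {g : Ω → E} (hg : Integrable g μ)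
    (hmem : ∀ᵐ x ∂μ, g x ∈ C) : ∫ x, g x ∂μ ∈ C := by
  induction hn : Module.finrank ℝ E using Nat.strong_induction_on generalizing E with
  | _ n ih =>
    by_contra hm
    set m := ∫ x, g x ∂μ with hm_def
    have hne : C.Nonempty := hmem.exists.elim fun x hx => ⟨_, hx⟩
    obtain ⟨L, hL, h⟩ := hC.exists_ne_zero_forall_le_or_forall_eq hne hm
    have hLint : ∫ x, L (g x) ∂μ = L m := L.integral_comp_comm hg
    have hle : ∀ᵐ x ∂μ, L (g x) ≤ L m := by
      rcases h with h | ⟨c, hc⟩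
      · exact hmem.mono fun x hx => h _ hx
      -- If `L` is constant on `C`, averaging forces the constant to be `L m`.
      · have : L m = c := by
          rw [← hLint, integral_congr_ae (g := fun _ => c) (hmem.mono fun x hx => hc _ hx)]
          simp
        exact hmem.mono fun x hx => (hc _ hx).trans this.symm |>.le
    have hLg : Integrable (fun x => L (g x)) μ := L.integrable_comp hg
    -- A non-negative function of mean zero vanishes almost everywhere, so `g - m` lies almost
    -- surely in the hyperplane `ker L`, where induction on the dimension applies.
    have heq : ∀ᵐ x ∂μ, L (g x) = L m := by
      have h0 : 0 ≤ᵐ[μ] fun x => L m - L (g x) := hle.mono fun x hx => sub_nonneg.2 hx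
      have h1 : ∫ x, (L m - L (g x)) ∂μ = 0 := by
        rw [integral_sub (integrable_const _) hLg, hLint]; simp
      exact ((integral_eq_zero_iff_of_nonneg_ae h0 ((integrable_const _).sub hLg)).1 h1).mono
        fun x hx => (sub_eq_zero.1 hx).symm
    let K : Submodule ℝ E := LinearMap.ker (L : E →ₗ[ℝ] ℝ)
    -- Projecting onto `K` gives a `K`-valued function defined everywhere that agrees with `g - m`
    -- almost everywhere.
    obtain ⟨π, hπ⟩ := Submodule.ClosedComplemented.of_finiteDimensional (𝕜 := ℝ) K
    have hlt : Module.finrank ℝ K < n := by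
      rw [← hn]
      refine Submodule.finrank_lt fun h => hL ?_
      ext x
      have : x ∈ K := h ▸ Submodule.mem_top
      exact this
    have hgm : Integrable (fun x => g x - m) μ := hg.sub (integrable_const _)
    have hzero : ∫ x, π (g x - m) ∂μ = 0 := by
      rw [π.integral_comp_comm hgm, integral_sub hg (integrable_const _)]
      simp [← hm_def]
    have hC' : Convex ℝ {y : K | (y : E) + m ∈ C} :=
      (hC.translate_preimage_left m).linear_preimage K.subtype
    have key := ih _ hlt hC' (π.integrable_comp hgm) (by
      filter_upwards [hmem, heq] with x hx hx'
      have : g x - m ∈ K := by simp [K, hx']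
      have h2 := congrArg Subtype.val (hπ ⟨_, this⟩)
      change ((π (g x - m) : K) : E) + m ∈ C
      rw [h2]
      simpa using hx) rfl
    rw [hzero] at key
    exact hm (by simpa using key)

/-! ### Finitely supported measures with prescribed means -/

/-- Finitely many bounded measurable functions have the same means under a suitable finitely supported
probability measure as under a given one. -/
theorem exists_finite_weights_lintegral_eq {Ω : Type*} [MeasurableSpace Ω] (μ : Measure Ω)
    [IsProbabilityMeasure μ] {κ : Type*} [Finite κ] (f : κ → Ω → ℝ≥0∞)
    (hf : ∀ k, Measurable (f k)) (hf1 : ∀ k x, f k x ≤ 1) :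
    ∃ (n : ℕ) (c : Fin n → ℝ≥0∞) (z : Fin n → Ω), ∑ i, c i = 1 ∧
      ∀ k, ∑ i, c i * f k (z i) = ∫⁻ x, f k x ∂μ := by
  have := Fintype.ofFinite κ
  have hfin : ∀ k x, f k x ≠ ∞ := fun k x => ((hf1 k x).trans_lt ENNReal.one_lt_top).ne
  let g : Ω → κ → ℝ := fun x k => (f k x).toReal
  have hg : ∀ k, Integrable (fun x => g x k) μ := fun k =>
    Integrable.of_bound (hf k).ennreal_toReal.aestronglyMeasurable 1 (ae_of_all _ fun x => by
      simpa [g] using ENNReal.toReal_mono ENNReal.one_ne_top (hf1 k x))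
  have hmem := (convex_convexHull ℝ (Set.range g)).integral_mem_of_finiteDimensional μ
    (Integrable.of_eval hg) (ae_of_all _ fun x => subset_convexHull ℝ _ ⟨x, rfl⟩)
  rw [mem_convexHull_iff_exists_fintype] at hmem
  obtain ⟨ι, _, c, y, hc0, hc1, hy, hsum⟩ := hmem
  choose z hz using hy
  let e := Fintype.equivFin ι
  have hE : ∀ F : ι → ℝ≥0∞, ∑ i, F (e.symm i) = ∑ i, F i := fun F => e.symm.sum_comp F
  refine ⟨Fintype.card ι, fun i => ENNReal.ofReal (c (e.symm i)), fun i => z (e.symm i), ?_,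
    fun k => ?_⟩
  · rw [hE (fun i => ENNReal.ofReal (c i)), ← ENNReal.ofReal_sum_of_nonneg fun i _ => hc0 i, hc1,
      ENNReal.ofReal_one]
  · rw [hE (fun i => ENNReal.ofReal (c i) * f k (z i))]
    have h1 : ∀ i, ENNReal.ofReal (c i) * f k (z i) = ENNReal.ofReal (c i * g (z i) k) := fun i => by
      rw [ENNReal.ofReal_mul (hc0 i), ENNReal.ofReal_toReal (hfin _ _)]
    have h2 : ∑ i, c i * g (z i) k = ∫ x, g x k ∂μ := by
      rw [← eval_integral hg, ← hsum]
      simp [hz]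
    simp only [h1]
    rw [← ENNReal.ofReal_sum_of_nonneg fun i _ => mul_nonneg (hc0 i) ENNReal.toReal_nonneg, h2,
      ofReal_integral_eq_lintegral_ofReal (hg k) (ae_of_all _ fun x => ENNReal.toReal_nonneg)]
    exact lintegral_congr fun x => ENNReal.ofReal_toReal (hfin _ _)

theorem lintegral_sum_smul_dirac {Ω : Type*} [MeasurableSpace Ω] {n : ℕ} (c : Fin n → ℝ≥0∞)
    (z : Fin n → Ω) {f : Ω → ℝ≥0∞} (hf : Measurable f) :
    ∫⁻ x, f x ∂(∑ i, c i • Measure.dirac (z i)) = ∑ i, c i * f (z i) := by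
  simp [lintegral_finsetSum_measure, lintegral_dirac' _ hf]

/-! ### Test functions for a single gate -/

namespace HiddenVariableModel

variable {V : Type u} {G : CausalStructure V} {O : V → Type v} [∀ v, MeasurableSpace (O v)]
  (M : HiddenVariableModel.{u, v, w} G O)

theorem iteratedIntegral_le_one (o : ∀ v, O v) (l : List V) (x : M.Config) :
    M.iteratedIntegral o l x ≤ 1 := by
  induction l generalizing x with
  | nil => exact le_rfl
  | cons v l ih =>
    calc M.iteratedIntegral o (v :: l) x
        ≤ ∫⁻ _ in {p : O v × (∀ e : G.Out v, M.X e.1) | p.1 = o v}, 1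
            ∂(M.gate v (fun e => x e.1)) := lintegral_mono fun p => ih _
      _ ≤ 1 := by
        rw [lintegral_one, Measure.restrict_apply_univ]
        exact prob_le_one

/-- The test function whose mean under the gate of `v` is the iterated integral along `v :: t`. -/
noncomputable def integrand (o : ∀ v, O v) (v : V) (t : List V) (x : M.Config) :
    O v × (∀ e : G.Out v, M.X e.1) → ℝ≥0∞ :=
  {p | p.1 = o v}.indicator fun p => M.iteratedIntegral o t (M.overwrite v x p.2)

theorem integrand_of_eq (o : ∀ v, O v) (v : V) (t : List V) (x : M.Config)
    {p : O v × (∀ e : G.Out v, M.X e.1)} (hp : p.1 = o v) :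
    M.integrand o v t x p = M.iteratedIntegral o t (M.overwrite v x p.2) := by
  simp [integrand, hp]

theorem integrand_of_ne (o : ∀ v, O v) (v : V) (t : List V) (x : M.Config)
    {p : O v × (∀ e : G.Out v, M.X e.1)} (hp : p.1 ≠ o v) : M.integrand o v t x p = 0 := by
  simp [integrand, hp]

theorem integrand_le_one (o : ∀ v, O v) (v : V) (t : List V) (x : M.Config)
    (p : O v × (∀ e : G.Out v, M.X e.1)) : M.integrand o v t x p ≤ 1 := by
  unfold integrand
  exact (Set.indicator_le_self _ _ _).trans (M.iteratedIntegral_le_one o t _)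

/-- Values on edges leaving `v` are overwritten and those on edges leaving `t` are integrated out.
Hence finite sets on the remaining edges leave only finitely many test functions. -/
theorem integrand_congr (o : ∀ v, O v) {v : V} {t : List V} (ht : G.IsOrdered t) (x x' : M.Config)
    (h : ∀ e, G.src e ∉ v :: t → x e = x' e) : M.integrand o v t x = M.integrand o v t x' := by
  unfold integrand
  congr 1
  funext p
  refine M.iteratedIntegral_congr o ht _ _ fun e he => ?_
  unfold overwrite
  by_cases h' : G.src e = v
  · simp [h']
  · simp only [h', dite_false]
    exact h e fun hmem => (List.mem_cons.1 hmem).elim h' he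

variable [∀ v, DiscreteMeasurableSpace (O v)]

theorem measurableSet_outcome_eq (v : V) (a : O v) :
    MeasurableSet {p : O v × (∀ e : G.Out v, M.X e.1) | p.1 = a} :=
  measurable_fst (MeasurableSet.of_discrete (s := {a}))

theorem measurable_integrand (o : ∀ v, O v) (v : V) (t : List V) (x : M.Config) :
    Measurable (M.integrand o v t x) :=
  ((M.measurable_iteratedIntegral o t).comp ((M.measurable_overwrite v).comp
    (measurable_const.prodMk measurable_snd))).indicator (M.measurableSet_outcome_eq v _)

theorem iteratedIntegral_cons (o : ∀ v, O v) (v : V) (t : List V) (x : M.Config) :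
    M.iteratedIntegral o (v :: t) x =
      ∫⁻ p, M.integrand o v t x p ∂(M.gate v fun e => x e.1) :=
  (lintegral_indicator (M.measurableSet_outcome_eq v _) _).symm

/-! ### Choosing the finite sets of values -/

/-- On finite sets `F e` of values of the hidden variables, the gate of `v` can be replaced by one
with finitely many values in `F` such that the iterated integral along `v :: t` is unchanged. -/
def IsFinitelySimulable (F : ∀ e, Finset (M.X e)) (v : V) (t : List V) : Prop :=
  ∀ a : ∀ e : G.In v, M.X e.1, (∀ e, a e ∈ F e.1) →
    ∃ (n : ℕ) (c : Fin n → ℝ≥0∞) (z : Fin n → O v × ∀ e : G.Out v, M.X e.1),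
      (∀ i e, (z i).2 e ∈ F e.1) ∧ ∑ i, c i = 1 ∧
        ∀ (o : ∀ v, O v) (x : M.Config), (∀ e, x e ∈ F e) → (∀ e : G.In v, x e.1 = a e) →
          ∑ i, c i * M.integrand o v t x (z i) = M.iteratedIntegral o (v :: t) x

variable [Finite V]

/-- The finite sets of values can be extended along a topologically ordered list. -/
theorem exists_finset_isFinitelySimulable [∀ v, Finite (O v)] {l : List V} (hl : G.IsOrdered l)
    (F₀ : ∀ e, Finset (M.X e)) (hF₀ : ∀ e, (F₀ e).Nonempty) :
    ∃ F : ∀ e, Finset (M.X e), (∀ e, (F e).Nonempty) ∧ (∀ e, G.src e ∉ l → F e = F₀ e) ∧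
      ∀ v t, v :: t <:+ l → M.IsFinitelySimulable F v t := by
  classical
  have := Fintype.ofFinite V
  induction l generalizing F₀ with
  | nil => exact ⟨F₀, hF₀, fun _ _ => rfl, fun v t h => by simp at h⟩
  | cons v l ih =>
    have hl' : G.IsOrdered l := ⟨(List.nodup_cons.1 hl.1).2, (List.pairwise_cons.1 hl.2).2⟩
    have hsim : ∀ a : ∀ e : G.In v, F₀ e.1,
        ∃ (n : ℕ) (c : Fin n → ℝ≥0∞) (z : Fin n → O v × ∀ e : G.Out v, M.X e.1), ∑ i, c i = 1 ∧
          ∀ k : (∀ v, O v) × (∀ e, F₀ e), ∑ i, c i * M.integrand k.1 v l (fun e => k.2 e) (z i) =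
            ∫⁻ p, M.integrand k.1 v l (fun e => k.2 e) p ∂(M.gate v fun e => a e) := fun a =>
      exists_finite_weights_lintegral_eq _
        (fun k : (∀ v, O v) × (∀ e, F₀ e) => M.integrand k.1 v l fun e => k.2 e)
        (fun k => M.measurable_integrand _ _ _ _) (fun k => M.integrand_le_one _ _ _ _)
    choose n c z hc hz using hsim
    -- Weights with sum 1 need at least one support point; this keeps the new sets non-empty.
    have hn : ∀ a, 0 < n a := fun a => Nat.pos_of_ne_zero fun h => by
      have h1 := hc a
      have : IsEmpty (Fin (n a)) := by rw [h]; infer_instance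
      simp at h1
    -- An edge leaving `v` receives the coordinates of all support points, over all finitely many
    -- inputs of `v`.
    let F₁ : ∀ e, Finset (M.X e) := fun e => if h : G.src e = v then
      Finset.univ.biUnion fun a : ∀ e : G.In v, F₀ e.1 =>
        Finset.univ.image fun i => (z a i).2 ⟨e, h⟩ else F₀ e
    have hF₁ : ∀ e, (F₁ e).Nonempty := fun e => by
      by_cases h : G.src e = v
      · simp only [F₁, h, dite_true]
        let a : ∀ e : G.In v, F₀ e.1 := fun e => ⟨(hF₀ e.1).choose, (hF₀ e.1).choose_spec⟩
        exact ⟨_, Finset.mem_biUnion.2 ⟨a, Finset.mem_univ _,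
          Finset.mem_image_of_mem _ (Finset.mem_univ ⟨0, hn a⟩)⟩⟩
      · simpa only [F₁, h, dite_false] using hF₀ e
    obtain ⟨F, hF, hFF₁, hFsim⟩ := ih hl' F₁ hF₁
    have hold : ∀ e, G.src e ∉ v :: l → F e = F₀ e := fun e he => by
      rw [List.mem_cons, not_or] at he
      rw [hFF₁ e he.2]
      simp only [F₁, he.1, dite_false]
    refine ⟨F, hF, hold, fun w t hwt => ?_⟩
    rcases List.suffix_cons_iff.1 hwt with h | h
    swap
    · exact hFsim w t h
    obtain ⟨rfl, rfl⟩ := List.cons.inj h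
    have hin : ∀ e : G.In w, G.src e.1 ∉ w :: t := fun e hmem => by
      have hadj : G.Adj (G.src e.1) w := by
        have h1 := e.1.2
        rwa [show e.1.1.2 = w from e.2] at h1
      rcases List.mem_cons.1 hmem with h' | h'
      · rw [h'] at hadj
        exact G.not_adj_self w hadj
      · exact (List.pairwise_cons.1 hl.2).1 _ h' hadj
    intro a ha
    -- Incoming edges start outside `w :: t`, so later extensions leave their sets unchanged.
    let a₀ : ∀ e : G.In w, F₀ e.1 := fun e => ⟨a e, hold e.1 (hin e) ▸ ha e⟩
    refine ⟨n a₀, c a₀, z a₀, fun i e => ?_, hc a₀, fun o x hx hxa => ?_⟩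
    · have he : G.src e.1 ∉ t := by
        rw [e.2]
        exact (List.nodup_cons.1 hl.1).1
      rw [hFF₁ e.1 he]
      simp only [F₁, e.2, dite_true]
      exact Finset.mem_biUnion.2 ⟨a₀, Finset.mem_univ _,
        Finset.mem_image_of_mem _ (Finset.mem_univ i)⟩
    -- `x` need not lie in `F₀` on edges leaving `w :: t`; arbitrary values there do not affect the
    -- integrand.
    · let x₀ : ∀ e, F₀ e := fun e => if h : G.src e ∉ w :: t then ⟨x e, hold e h ▸ hx e⟩
        else ⟨(hF₀ e).choose, (hF₀ e).choose_spec⟩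
      have hx₀ : ∀ e, G.src e ∉ w :: t → x e = x₀ e := fun e he => by
        simp only [x₀, he, not_false_eq_true, dite_true]
      have h1 := hz a₀ (o, x₀)
      simp only at h1
      rw [← M.integrand_congr o hl' x _ hx₀] at h1
      rw [h1, M.iteratedIntegral_cons]
      congr 2
      funext e
      exact (hxa e).symm

/-! ### The finite model and its joint distribution -/

/-- The model whose edges carry the finite sets `F e`, for given gates. -/
noncomputable def ofFinset (F : ∀ e, Finset (M.X e)) (hF : ∀ e, (F e).Nonempty)
    (n : ∀ v, (∀ e : G.In v, F e.1) → ℕ)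
    (c : ∀ v a, Fin (n v a) → ℝ≥0∞) (hc : ∀ v a, ∑ i, c v a i = 1)
    (z : ∀ v a, Fin (n v a) → O v × ∀ e : G.Out v, F e.1) :
    HiddenVariableModel.{u, v, w} G O :=
  letI : ∀ e, MeasurableSpace (F e) := fun _ => ⊤
  haveI : ∀ e, DiscreteMeasurableSpace (F e) := fun _ => ⟨fun _ => trivial⟩
  { X := fun e => F e
    measurableSpace := fun _ => ⊤
    nonempty := fun e => (hF e).to_subtype
    gate := fun v => Kernel.ofFunOfCountable fun a =>
      ∑ i, c v a i • Measure.dirac (z v a i)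
    isMarkovKernel := fun v => ⟨fun a => ⟨by
      simp [Kernel.ofFunOfCountable, Measure.finsetSum_apply, hc]⟩⟩ }

/-- By induction the tail integrals of both models agree on `F`, so the new gate sums the original
test function over its support points, and `h` turns this sum into the original integral. -/
theorem iteratedIntegral_ofFinset (F : ∀ e, Finset (M.X e)) (hF : ∀ e, (F e).Nonempty)
    (n : ∀ v, (∀ e : G.In v, F e.1) → ℕ)
    (c : ∀ v a, Fin (n v a) → ℝ≥0∞) (hc : ∀ v a, ∑ i, c v a i = 1)
    (z : ∀ v a, Fin (n v a) → O v × ∀ e : G.Out v, F e.1) (o : ∀ v, O v) {l : List V}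
    (h : ∀ v t, v :: t <:+ l → ∀ x : ∀ e, F e,
      ∑ i, c v (fun e => x e.1) i * M.integrand o v t (fun e => x e)
        ((z v (fun e => x e.1) i).1, fun e => (z v (fun e => x e.1) i).2 e) =
          M.iteratedIntegral o (v :: t) (fun e => x e)) (x : ∀ e, F e) :
    (M.ofFinset F hF n c hc z).iteratedIntegral o l x = M.iteratedIntegral o l (fun e => x e) := by
  induction l generalizing x with
  | nil => rfl
  | cons v l ih =>
    have ih' := ih fun w t hwt => h w t (hwt.trans (List.suffix_cons v l))
    rw [← h v l List.suffix_rfl x]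
    refine (iteratedIntegral_cons (M.ofFinset F hF n c hc z) o v l x).trans ?_
    refine (lintegral_sum_smul_dirac
      (Ω := O v × ∀ e : G.Out v, (M.ofFinset F hF n c hc z).X e.1) (c v fun e => x e.1)
      (z v fun e => x e.1) ((M.ofFinset F hF n c hc z).measurable_integrand o v l x)).trans ?_
    refine Finset.sum_congr rfl fun i _ => ?_
    congr 1
    by_cases hp : (z v (fun e => x e.1) i).1 = o v
    · refine (integrand_of_eq (M.ofFinset F hF n c hc z) o v l x hp).trans
        (((ih' _).trans (congrArg _ ?_)).trans (M.integrand_of_eq o v l _ hp).symm)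
      funext e
      unfold overwrite
      by_cases he : G.src e = v
      · simp only [he, dite_true]
        exact congrArg Subtype.val (dif_pos he)
      · simp only [he, dite_false]
        exact congrArg Subtype.val (dif_neg he)
    · exact (integrand_of_ne (M.ofFinset F hF n c hc z) o v l x hp).trans
        (M.integrand_of_ne o v l _ hp).symm

/-- Every hidden variable model has the same joint distribution as one with finite spaces. -/
theorem exists_finite_prob_eq [∀ v, Finite (O v)] :
    ∃ M' : HiddenVariableModel.{u, v, w} G O,
      (∀ e, Finite (M'.X e) ∧ DiscreteMeasurableSpace (M'.X e)) ∧ ∀ o, M'.prob o = M.prob o := by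
  obtain ⟨l, hl, hmem⟩ := G.exists_topologicalOrder
  obtain ⟨F, hF, -, hsim⟩ := M.exists_finset_isFinitelySimulable hl
    -- Every edge has its source in `l`, so these starting singletons are all replaced.
    (fun e => {Classical.arbitrary (M.X e)}) fun e => Finset.singleton_nonempty _
  have hsuffix : ∀ v, ∃ t, v :: t <:+ l := fun v => by
    obtain ⟨s, t, h⟩ := List.append_of_mem (hmem v)
    exact ⟨t, s, h.symm⟩
  -- As `l` has no duplicates, the tail after `v` is unique; thus the gate chosen for `τ v` fits
  -- wherever `v` occurs in the induction.
  have hunique : ∀ v t t', v :: t <:+ l → v :: t' <:+ l → t = t' := fun v t t' h h' => by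
    have key : ∀ t t', v :: t' <:+ l → v :: t <:+ v :: t' → t = t' := fun t t' h' h => by
      rcases List.suffix_cons_iff.1 h with h | h
      · exact (List.cons.inj h).2
      · exact ((List.nodup_cons.1 (hl.1.sublist h'.sublist)).1 (h.subset List.mem_cons_self)).elim
    rcases List.suffix_or_suffix_of_suffix h h' with h1 | h1
    · exact key t t' h' h1
    · exact (key t' t h h1).symm
  choose τ hτ using hsuffix
  choose n c z hz hc hsum using fun (v : V) (a : ∀ e : G.In v, F e.1) =>
    hsim v (τ v) (hτ v) (fun e => a e) fun e => (a e).2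
  refine ⟨M.ofFinset F hF n c hc fun v a i => ((z v a i).1, fun e => ⟨_, hz v a i e⟩), fun e =>
    ⟨inferInstanceAs (Finite (F e)), ⟨fun _ => trivial⟩⟩, fun o => ?_⟩
  have x : ∀ e, F e := fun e => ⟨(hF e).choose, (hF e).choose_spec⟩
  rw [prob_eq _ o hl hmem x, M.prob_eq o hl hmem fun e => x e]
  refine M.iteratedIntegral_ofFinset F hF n c hc _ o (fun v t hvt y => ?_) x
  obtain rfl := hunique v _ _ hvt (hτ v)
  exact hsum v _ o _ (fun e => (y e).2) fun e => rfl

end HiddenVariableModel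

theorem mainTheorem1 {V : Type u} [Finite V] (G : CausalStructure V) {O : V → Type v}
    [∀ v, Finite (O v)] [∀ v, MeasurableSpace (O v)] [∀ v, DiscreteMeasurableSpace (O v)]
    (P : (∀ v, O v) → ℝ) (hP : IsClassicalCorrelation.{u, v, w} G P) (ε : ℝ) (hε : 0 < ε) :
    ∃ P' : (∀ v, O v) → ℝ,
      IsClassicalCorrelation.{u, v, w} G P' ∧
      (∃ M' : HiddenVariableModel.{u, v, w} G O,
        M'.Realizes P' ∧ ∀ e, Finite (M'.X e) ∧ DiscreteMeasurableSpace (M'.X e)) ∧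
      ∀ o, |P o - P' o| < ε := by
  obtain ⟨M, hM⟩ := hP
  obtain ⟨M', hfin, hprob⟩ := M.exists_finite_prob_eq
  -- `P' = P` works, with error 0.
  exact ⟨P, ⟨M, hM⟩, ⟨M', fun o => by rw [hprob, hM o], hfin⟩, fun o => by simpa using hε⟩
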